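/- Let $N\ge 1$ be an integer and let $1<p\le q_0<p^*$ be real numbers, where $p^*=\frac{Np}{N-p}$ if $p<N$ and $p^*=\infty$ if $p\ge N$. There exists a constant $C=C(N,p,q_0)>0$ such that the following holds. Let $\Omega\subset\mathbb{R}^N$ be an open set with finite volume, let $p\le q\le q_0$ and $\lambda>0$, and let $u\in W^{1,p}_0(\Omega)$ (the closure of $C_0^\infty(\Omega)$ in $W^{1,p}(\Omega)$) be a non-negative (for instance, positive) weak solution of the Lane--Emden equation $-\Delta_p u=\lambda|u|^{q-2}u$ in $\Omega$, that is, $u\ge 0$ a.e. in $\Omega$ and \[ \int_\Omega\langle|\nabla u|^{p-2}\nabla u,\nabla\varphi\rangle\,dx=\lambda\int_\Omega |u|^{q-2}u\,\varphi\,dx\qquad\text{for every }\varphi\in W^{1,p}_0(\Omega). \] Then $u\in L^\infty(\Omega)$ and \[ \|u\|_{L^\infty(\Omega)}\le C\left(\lambda^{\frac{N}{pq}}\,\|u\|_{L^q(\Omega)}\right)^{\frac{pq}{pq-(q-p)N}}. \] -/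

import Mathlib

open MeasureTheory Filter Topology

open scoped ContDiff ENNReal

noncomputable section

/-- The critical Sobolev exponent `p^*` in dimension `N`: it equals `N p / (N - p)` when `p < N`,
and is `∞` when `N ≤ p`. Thus `q < p^*` is no restriction on a real number `q` when `N ≤ p`. -/
def sobolevExponent (N : ℕ) (p : ℝ) : EReal :=
  if p < (N : ℝ) then (((N : ℝ) * p / ((N : ℝ) - p) : ℝ) : EReal) else ⊤

/-- `φ` belongs to `C_0^∞(Ω)`: it is smooth, and its support is compact and contained in `Ω`. -/
structure IsTestFunction {N : ℕ} (Ω : Set (EuclideanSpace ℝ (Fin N)))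
    (φ : EuclideanSpace ℝ (Fin N) → ℝ) : Prop where
  smooth : ContDiff ℝ ∞ φ
  hasCompactSupport : HasCompactSupport φ
  tsupport_subset : tsupport φ ⊆ Ω

/-- `u` belongs to the Sobolev space `W^{1,p}(Ω)`, and `G` is (a representative of) its weak
gradient: both are in `L^p(Ω)` and `∫_Ω u ∇φ = - ∫_Ω φ G` for every `φ ∈ C_0^∞(Ω)`. -/
structure HasSobolevGradient {N : ℕ} (Ω : Set (EuclideanSpace ℝ (Fin N))) (p : ℝ)
    (u : EuclideanSpace ℝ (Fin N) → ℝ)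
    (G : EuclideanSpace ℝ (Fin N) → EuclideanSpace ℝ (Fin N)) : Prop where
  memLp : MemLp u (ENNReal.ofReal p) (volume.restrict Ω)
  memLp_grad : MemLp G (ENNReal.ofReal p) (volume.restrict Ω)
  integral_eq : ∀ φ : EuclideanSpace ℝ (Fin N) → ℝ, IsTestFunction Ω φ →
    ∫ x in Ω, u x • gradient φ x = - ∫ x in Ω, φ x • G x

/-- `u` belongs to `W^{1,p}_0(Ω)`, the closure of `C_0^∞(Ω)` in `W^{1,p}(Ω)`, and `G` is (a
representative of) its weak gradient. -/
structure HasSobolevGradientZero {N : ℕ} (Ω : Set (EuclideanSpace ℝ (Fin N))) (p : ℝ)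
    (u : EuclideanSpace ℝ (Fin N) → ℝ)
    (G : EuclideanSpace ℝ (Fin N) → EuclideanSpace ℝ (Fin N)) : Prop
    extends HasSobolevGradient Ω p u G where
  exists_approx : ∃ φ : ℕ → EuclideanSpace ℝ (Fin N) → ℝ,
    (∀ n, IsTestFunction Ω (φ n)) ∧
    Tendsto (fun n => eLpNorm (fun x => φ n x - u x) (ENNReal.ofReal p) (volume.restrict Ω))
      atTop (𝓝 0) ∧
    Tendsto (fun n => eLpNorm (fun x => gradient (φ n) x - G x) (ENNReal.ofReal p)
      (volume.restrict Ω)) atTop (𝓝 0)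

/-- `u ∈ W^{1,p}_0(Ω)` is a weak solution of the Lane-Emden equation
`-Δ_p u = lam |u|^{q-2} u` in `Ω`:
`∫_Ω ⟨|∇u|^{p-2} ∇u, ∇φ⟩ = lam ∫_Ω |u|^{q-2} u φ` for every `φ ∈ W^{1,p}_0(Ω)`. -/
def IsLaneEmdenSolution {N : ℕ} (Ω : Set (EuclideanSpace ℝ (Fin N))) (p q lam : ℝ)
    (u : EuclideanSpace ℝ (Fin N) → ℝ) : Prop :=
  ∃ G : EuclideanSpace ℝ (Fin N) → EuclideanSpace ℝ (Fin N),
    HasSobolevGradientZero Ω p u G ∧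
    ∀ (φ : EuclideanSpace ℝ (Fin N) → ℝ)
      (H : EuclideanSpace ℝ (Fin N) → EuclideanSpace ℝ (Fin N)),
      HasSobolevGradientZero Ω p φ H →
        ∫ x in Ω, inner ℝ (‖G x‖ ^ (p - 2) • G x) (H x) =
          lam * ∫ x in Ω, |u x| ^ (q - 2) * u x * φ x

end

/-! The proof is De Giorgi's iteration on the norms `Y k = ‖(u - k)^+‖_q`. Testing the equation with
`(u - k)^+` gives `‖∇(u - k)^+‖_p ^ p = lam * ∫ u^(q-1) (u - k)^+`, and for `h < k` the right side
is at most `lam * (k / (k - h))^(q-1) * Y h ^ q`, because `u ≤ k / (k - h) * (u - h)` wherever `u >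
k`. Sobolev and Hölder on `{u > k}` bound `Y k` by this gradient norm times the power `1/q - 1/p +
1/N` of the measure of `{u > k}`, and Chebyshev bounds that measure by `(Y h / (k - h))^q`.

With `a = 1 - q/p + q/N`, the resulting inequality
(`HasSobolevGradientZero.toReal_eLpNorm_posPart_le`) carries `Y h` to the power `a + q/p = 1 + q/N >
1`. Along levels rising geometrically from `0` to `M` this superlinearity beats the growing
coefficients (`tendsto_zero_of_le_mul_rpow`), so `Y M = 0` once `M^a` dominates a multiple of
`lam^(1/p) * ‖u‖_q^(q/N)`. Solving for `M` gives the stated estimate. Subcriticality of `q₀` makes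
`a` positive, with a lower bound independent of `q`, so one constant serves every `q`.

The other ingredient is that `(u - k)^+` belongs to `W^{1,p}_0`
(`HasSobolevGradientZero.posPart_sub`), obtained from a chain rule for smooth functions and a limit.
-/

/-! ### Sobolev inequalities for smooth compactly supported functions -/

theorem norm_gradient_eq_norm_fderiv {E : Type*} [NormedAddCommGroup E] [InnerProductSpace ℝ E]
    [CompleteSpace E] (f : E → ℝ) (x : E) : ‖gradient f x‖ = ‖fderiv ℝ f x‖ := by
  simp [gradient]

/-- The fundamental theorem of calculus, transported from `ℝ` by a linear isometry. It is the
endpoint `p₁ = 1`, `q₁ = ∞` needed in dimension one. -/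
theorem eLpNorm_top_le_eLpNorm_one_fderiv {φ : EuclideanSpace ℝ (Fin 1) → ℝ}
    (hφ : ContDiff ℝ 1 φ) (hc : HasCompactSupport φ) :
    eLpNorm φ ⊤ volume ≤ eLpNorm (fderiv ℝ φ) 1 volume := by
  let e : ℝ ≃ₗᵢ[ℝ] EuclideanSpace ℝ (Fin 1) := (OrthonormalBasis.singleton (Fin 1) ℝ).repr
  have he : MeasurePreserving e := e.measurePreserving
  have hd : ∀ t : ℝ, ‖deriv (φ ∘ e) t‖ₑ ≤ ‖fderiv ℝ φ (e t)‖ₑ := by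
    intro t
    have h : HasFDerivAt (φ ∘ e) ((fderiv ℝ φ (e t)).comp (e : ℝ →L[ℝ] EuclideanSpace ℝ (Fin 1))) t :=
      ((hφ.differentiable one_ne_zero (e t)).hasFDerivAt).comp t
        (e : ℝ →L[ℝ] EuclideanSpace ℝ (Fin 1)).hasFDerivAt
    rw [h.hasDerivAt.deriv, enorm_le_iff_norm_le]
    calc _ ≤ ‖fderiv ℝ φ (e t)‖ * ‖e 1‖ := ContinuousLinearMap.le_opNorm _ _
      _ = _ := by simp
  rw [eLpNorm_exponent_top]
  refine eLpNormEssSup_le_of_ae_enorm_bound (ae_of_all _ fun x => ?_)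
  obtain ⟨t, rfl⟩ := e.surjective x
  have hf : ContDiff ℝ 1 (φ ∘ e) := hφ.comp e.contDiff
  have hfc : HasCompactSupport (φ ∘ e) := hc.comp_homeomorph e.toHomeomorph
  calc ‖φ (e t)‖ₑ ≤ ∫⁻ s in Set.Iic t, ‖deriv (φ ∘ e) s‖ₑ :=
        hfc.enorm_le_lintegral_Ici_deriv hf t
    _ ≤ ∫⁻ s, ‖deriv (φ ∘ e) s‖ₑ := setLIntegral_le_lintegral _ _
    _ ≤ ∫⁻ s, ‖fderiv ℝ φ (e s)‖ₑ := lintegral_mono hd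
    _ = ∫⁻ x, ‖fderiv ℝ φ x‖ₑ :=
        he.lintegral_comp (f := fun x => ‖fderiv ℝ φ x‖ₑ)
          (hφ.continuous_fderiv one_ne_zero).measurable.enorm
    _ = _ := by rw [eLpNorm_one_eq_lintegral_enorm]

/-- A form of subcriticality that does not distinguish `p < N` from `p ≥ N`: in the latter case the
left side is nonpositive. -/
theorem one_div_sub_lt_of_lt_sobolevExponent {N : ℕ} {p q : ℝ} (hN : 1 ≤ N) (hp : 1 < p)
    (hpq : p ≤ q) (hq : (q : EReal) < sobolevExponent N p) : 1 / p - 1 / N < 1 / q := by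
  have hN' : (0 : ℝ) < N := by exact_mod_cast hN
  have hp0 : 0 < p := by linarith
  have hq0 : 0 < q := by linarith
  unfold sobolevExponent at hq
  split_ifs at hq with h
  · have h1 : q < (N : ℝ) * p / (N - p) := by exact_mod_cast hq
    rw [lt_div_iff₀ (by linarith)] at h1
    rw [div_sub_div _ _ hp0.ne' hN'.ne', div_lt_div_iff₀ (by positivity) hq0]
    linarith
  · have h1 : 1 / p ≤ 1 / (N : ℝ) := one_div_le_one_div_of_le hN' (not_lt.1 h)
    have : 0 < 1 / q := by positivity
    linarith

/-- A Sobolev inequality with exponents `p₁ ≤ p` and `q₁ ≥ q₀`, available whenever `q₀` is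
subcritical for `p`. -/
theorem exists_sobolev_constant {N : ℕ} {p q₀ : ℝ} (hN : 1 ≤ N) (hp : 1 < p)
    (hpq : p ≤ q₀) (hq : (q₀ : EReal) < sobolevExponent N p) :
    ∃ (S : ℝ) (p₁ q₁ : ℝ≥0∞), 1 ≤ S ∧ 1 ≤ p₁ ∧ p₁ ≤ ENNReal.ofReal p ∧ ENNReal.ofReal q₀ ≤ q₁ ∧
      1 / p₁.toReal - 1 / q₁.toReal = 1 / N ∧
      ∀ φ : EuclideanSpace ℝ (Fin N) → ℝ, ContDiff ℝ 1 φ → HasCompactSupport φ →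
        eLpNorm φ q₁ volume ≤ ENNReal.ofReal S * eLpNorm (gradient φ) p₁ volume := by
  have key := one_div_sub_lt_of_lt_sobolevExponent hN hp hpq hq
  have hgrad : ∀ (φ : EuclideanSpace ℝ (Fin N) → ℝ) (r : ℝ≥0∞),
      eLpNorm (gradient φ) r volume = eLpNorm (fderiv ℝ φ) r volume := fun φ r =>
    eLpNorm_congr_norm_ae (ae_of_all _ fun x => norm_gradient_eq_norm_fderiv φ x)
  simp_rw [hgrad]
  rcases hN.eq_or_lt with rfl | hN2
  · refine ⟨1, 1, ⊤, le_rfl, le_rfl, ?_, le_top, by simp, fun φ h1 h2 => ?_⟩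
    · simpa using hp.le
    · simpa using eLpNorm_top_le_eLpNorm_one_fderiv h1 h2
  have hN' : (2 : ℝ) ≤ N := by exact_mod_cast hN2
  have hp0 : 0 < p := by linarith
  have hq0 : 0 < q₀ := by linarith
  have hNi : 1 / (N : ℝ) ≤ 1 / 2 := one_div_le_one_div_of_le (by norm_num) hN'
  have hNi0 : 0 < 1 / (N : ℝ) := by positivity
  have hqi : 0 < 1 / q₀ := by positivity
  -- Here `r = 1 / p₁` and `s = r - 1 / N = 1 / q₁`. The cap at `1` ensures `p₁ ≥ 1`, the other term
  -- ensures `q₁ ≥ q₀`, and subcriticality gives `p₁ ≤ p`. Since `N ≥ 2`, `s` stays positive.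
  set r : ℝ := min 1 (1 / q₀ + 1 / N) with hr
  have hr1 : r ≤ 1 := min_le_left _ _
  have hr2 : r ≤ 1 / q₀ + 1 / N := min_le_right _ _
  have hrN : 1 / (N : ℝ) < r := lt_min (by linarith) (by linarith)
  have hrp : 1 / p ≤ r := le_min (by rw [div_le_one hp0]; exact hp.le) (by linarith)
  have hr0 : 0 < r := by linarith
  set s : ℝ := r - 1 / N with hs
  have hs0 : 0 < s := by linarith
  set P : NNReal := (1 / r).toNNReal with hP
  have hPr : (P : ℝ) = 1 / r := Real.coe_toNNReal _ (by positivity)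
  set Q : NNReal := (1 / s).toNNReal with hQ
  have hQs : (Q : ℝ) = 1 / s := Real.coe_toNNReal _ (by positivity)
  have hP1 : 1 ≤ P := by
    rw [← NNReal.coe_le_coe, hPr, NNReal.coe_one, le_div_iff₀ hr0]; linarith
  -- The constant is raised to at least `1` so that increasing an exponent over it can only enlarge
  -- it later.
  refine ⟨max 1 (SNormLESNormFDerivOfEqConst ℝ
    (volume : Measure (EuclideanSpace ℝ (Fin N))) P : ℝ), P, Q, le_max_left _ _, by exact_mod_cast hP1,
    ?_, ?_, ?_, fun φ h1 h2 => ?_⟩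
  · rw [hP]
    refine ENNReal.ofReal_le_ofReal ?_
    rw [div_le_iff₀ hr0]
    rwa [div_le_iff₀ hp0, mul_comm] at hrp
  · rw [hQ]
    refine ENNReal.ofReal_le_ofReal ?_
    rw [le_div_iff₀ hs0, ← le_div_iff₀' hq0]
    linarith
  · rw [ENNReal.coe_toReal, ENNReal.coe_toReal, hPr, hQs]
    simp [hs]
  · have := eLpNorm_le_eLpNorm_fderiv_of_eq (F := ℝ)
      (volume : Measure (EuclideanSpace ℝ (Fin N))) h1 h2
      (p := P) (p' := Q) hP1 (by rw [finrank_euclideanSpace_fin]; omega) (by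
        rw [NNReal.coe_inv, hPr, hQs]; simp [hs])
    refine this.trans ?_
    gcongr
    rw [← ENNReal.ofReal_coe_nnreal]
    exact ENNReal.ofReal_le_ofReal (le_max_right _ _)

/-! ### Limits in `L^p` and of integrals -/

/-- Dominated convergence in `L^p`. -/
theorem tendsto_eLpNorm_zero_of_dominated {α E : Type*} {m : MeasurableSpace α} {μ : Measure α}
    [NormedAddCommGroup E] {p : ℝ} (hp : 0 < p) {f : ℕ → α → E} {g : α → ℝ}
    (hf : ∀ n, AEStronglyMeasurable (f n) μ) (hg : MemLp g (ENNReal.ofReal p) μ)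
    (hfg : ∀ n, ∀ᵐ x ∂μ, ‖f n x‖ ≤ g x)
    (hlim : ∀ᵐ x ∂μ, Tendsto (fun n => f n x) atTop (𝓝 0)) :
    Tendsto (fun n => eLpNorm (f n) (ENNReal.ofReal p) μ) atTop (𝓝 0) := by
  have h0 : ENNReal.ofReal p ≠ 0 := by simpa using hp
  have key : Tendsto (fun n => ∫⁻ x, ‖f n x‖ₑ ^ p ∂μ) atTop (𝓝 (∫⁻ _, 0 ∂μ)) := by
    refine tendsto_lintegral_of_dominated_convergence' (fun x => ‖g x‖ₑ ^ p)
      (fun n => (hf n).enorm.pow_const p) (fun n => ?_) ?_ ?_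
    · filter_upwards [hfg n] with x hx
      gcongr
      rw [enorm_le_iff_norm_le]
      exact hx.trans (le_abs_self _)
    · have := lintegral_rpow_enorm_lt_top_of_eLpNorm_lt_top h0 ENNReal.ofReal_ne_top hg.2
      rw [ENNReal.toReal_ofReal hp.le] at this
      exact this.ne
    · filter_upwards [hlim] with x hx
      have h1 := (hx.enorm).ennrpow_const p
      simpa [ENNReal.zero_rpow_of_pos hp] using h1
  have := key.ennrpow_const (1 / p)
  simp only [lintegral_zero, ENNReal.zero_rpow_of_pos (one_div_pos.2 hp)] at this
  refine this.congr fun n => ?_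
  rw [eLpNorm_eq_lintegral_rpow_enorm_toReal h0 ENNReal.ofReal_ne_top, ENNReal.toReal_ofReal hp.le]

theorem tendsto_eLpNorm_zero_of_le {α E : Type*} {m : MeasurableSpace α} {μ : Measure α}
    [NormedAddCommGroup E] [IsFiniteMeasure μ] {r s : ℝ≥0∞} (hrs : r ≤ s) {f : ℕ → α → E}
    (hf : ∀ n, AEStronglyMeasurable (f n) μ)
    (h : Tendsto (fun n => eLpNorm (f n) s μ) atTop (𝓝 0)) (hr : r ≠ 0) :
    Tendsto (fun n => eLpNorm (f n) r μ) atTop (𝓝 0) := by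
  have hc : μ Set.univ ^ (1 / r.toReal - 1 / s.toReal) ≠ ⊤ := by
    refine ENNReal.rpow_ne_top_of_nonneg ?_ (measure_ne_top _ _)
    rcases eq_or_ne s ⊤ with rfl | hs
    · simp
    · have h1 : r.toReal ≤ s.toReal := ENNReal.toReal_mono hs hrs
      have h2 : 0 < r.toReal := ENNReal.toReal_pos hr (ne_top_of_le_ne_top hs hrs)
      linarith [one_div_le_one_div_of_le h2 h1]
  have h2 := ENNReal.Tendsto.mul_const (b := μ Set.univ ^ (1 / r.toReal - 1 / s.toReal)) h
    (Or.inr hc)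
  rw [zero_mul] at h2
  exact tendsto_of_tendsto_of_tendsto_of_le_of_le tendsto_const_nhds h2 (fun _ => zero_le)
    fun n => eLpNorm_le_eLpNorm_mul_rpow_measure_univ hrs (hf n)

theorem tendsto_integral_smul_of_tendsto_eLpNorm_one {α E : Type*} {m : MeasurableSpace α}
    {μ : Measure α} [NormedAddCommGroup E] [NormedSpace ℝ E] {f : ℕ → α → ℝ} {f₀ : α → ℝ}
    {g : α → E} (hg : MemLp g ⊤ μ) (hf : ∀ n, Integrable (f n) μ) (hf₀ : Integrable f₀ μ)
    (h : Tendsto (fun n => eLpNorm (fun x => f n x - f₀ x) 1 μ) atTop (𝓝 0)) :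
    Tendsto (fun n => ∫ x, f n x • g x ∂μ) atTop (𝓝 (∫ x, f₀ x • g x ∂μ)) := by
  refine tendsto_integral_of_L1' _ ((hf₀.1.smul hg.1))
    (Eventually.of_forall fun n => (hf n).smul_of_top_left hg) ?_
  have h2 := ENNReal.Tendsto.mul_const (b := eLpNorm g ⊤ μ) h (Or.inr hg.2.ne)
  rw [zero_mul] at h2
  refine tendsto_of_tendsto_of_tendsto_of_le_of_le tendsto_const_nhds h2 (fun _ => zero_le)
    fun n => ?_
  refine le_trans (le_of_eq ?_) (eLpNorm_smul_le_eLpNorm_mul_eLpNorm_top 1 g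
    ((hf n).1.sub hf₀.1))
  refine congrArg (fun w => eLpNorm w 1 μ) ?_
  ext x
  simp [sub_smul]

/-! ### Test functions and closure under approximation -/

section

variable {N : ℕ} {Ω : Set (EuclideanSpace ℝ (Fin N))} {p : ℝ}
  {u : EuclideanSpace ℝ (Fin N) → ℝ} {G : EuclideanSpace ℝ (Fin N) → EuclideanSpace ℝ (Fin N)}

theorem IsTestFunction.continuous_gradient {φ : EuclideanSpace ℝ (Fin N) → ℝ}
    (hφ : IsTestFunction Ω φ) : Continuous (gradient φ) :=
  (InnerProductSpace.toDual ℝ _).symm.continuous.comp (hφ.smooth.continuous_fderiv (by simp))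

theorem IsTestFunction.hasCompactSupport_gradient {φ : EuclideanSpace ℝ (Fin N) → ℝ}
    (hφ : IsTestFunction Ω φ) : HasCompactSupport (gradient φ) :=
  (hφ.hasCompactSupport.fderiv (𝕜 := ℝ)).comp_left (map_zero _)

theorem IsTestFunction.memLp {φ : EuclideanSpace ℝ (Fin N) → ℝ} (hφ : IsTestFunction Ω φ)
    (r : ℝ≥0∞) (μ : Measure (EuclideanSpace ℝ (Fin N))) [IsFiniteMeasureOnCompacts μ] :
    MemLp φ r μ :=
  hφ.smooth.continuous.memLp_of_hasCompactSupport hφ.hasCompactSupport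

theorem IsTestFunction.memLp_gradient {φ : EuclideanSpace ℝ (Fin N) → ℝ}
    (hφ : IsTestFunction Ω φ) (r : ℝ≥0∞) (μ : Measure (EuclideanSpace ℝ (Fin N)))
    [IsFiniteMeasureOnCompacts μ] : MemLp (gradient φ) r μ :=
  hφ.continuous_gradient.memLp_of_hasCompactSupport hφ.hasCompactSupport_gradient

theorem IsTestFunction.eq_zero_of_notMem {φ : EuclideanSpace ℝ (Fin N) → ℝ}
    (hφ : IsTestFunction Ω φ) {x : EuclideanSpace ℝ (Fin N)} (hx : x ∉ Ω) : φ x = 0 :=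
  image_eq_zero_of_notMem_tsupport fun h => hx (hφ.tsupport_subset h)

theorem IsTestFunction.gradient_eq_zero_of_notMem {φ : EuclideanSpace ℝ (Fin N) → ℝ}
    (hφ : IsTestFunction Ω φ) {x : EuclideanSpace ℝ (Fin N)} (hx : x ∉ Ω) :
    gradient φ x = 0 := by
  have : fderiv ℝ φ x = 0 := by
    by_contra h
    exact hx (hφ.tsupport_subset (support_fderiv_subset ℝ h))
  simp [gradient, this]

/-- The integrands vanish off `Ω`, so both integrals extend to the whole space; pairing with a fixed
vector `v` leaves integration by parts for a directional derivative. -/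
theorem IsTestFunction.integral_smul_gradient {φ ψ : EuclideanSpace ℝ (Fin N) → ℝ}
    (hφ : IsTestFunction Ω φ) (hψ : IsTestFunction Ω ψ) :
    ∫ x in Ω, φ x • gradient ψ x = - ∫ x in Ω, ψ x • gradient φ x := by
  rw [setIntegral_eq_integral_of_forall_compl_eq_zero
      (fun x hx => by simp [hφ.eq_zero_of_notMem hx]),
    setIntegral_eq_integral_of_forall_compl_eq_zero
      (fun x hx => by simp [hψ.eq_zero_of_notMem hx])]
  have hi : ∀ {f g : EuclideanSpace ℝ (Fin N) → ℝ}, IsTestFunction Ω f → IsTestFunction Ω g →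
      Integrable (fun x => f x • gradient g x) volume := fun hf hg =>
    (memLp_one_iff_integrable.1 (hf.memLp 1 volume)).smul_of_top_left (hg.memLp_gradient ⊤ volume)
  have hin : ∀ (f : EuclideanSpace ℝ (Fin N) → ℝ) (x v : EuclideanSpace ℝ (Fin N)),
      inner ℝ v (gradient f x) = fderiv ℝ f x v := fun f x v => by
    rw [real_inner_comm, gradient, InnerProductSpace.toDual_symm_apply]
  refine ext_inner_left ℝ fun v => ?_
  rw [inner_neg_right, ← integral_inner (hi hφ hψ), ← integral_inner (hi hψ hφ)]
  simp only [inner_smul_right, hin]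
  have hi2 : ∀ {f g : EuclideanSpace ℝ (Fin N) → ℝ}, IsTestFunction Ω f → IsTestFunction Ω g →
      Integrable (fun x => f x * fderiv ℝ g x v) volume := fun hf hg => by
    have := (hi hf hg).const_inner v (𝕜 := ℝ)
    simpa only [inner_smul_right, hin] using this
  rw [integral_mul_fderiv_eq_neg_fderiv_mul_of_integrable (v := v) _ (hi2 hφ hψ) _
    (fun x _ => hφ.smooth.differentiable (by simp) x)
    (fun x _ => hψ.smooth.differentiable (by simp) x)]
  · simp_rw [mul_comm]
  · simpa only [mul_comm] using hi2 hψ hφ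
  · exact (memLp_one_iff_integrable.1 (hφ.memLp 1 volume)).smul_of_top_left (hψ.memLp ⊤ volume)

/-- On finite volume `L^p` convergence implies `L^1` convergence, so integration by parts passes to
the limit. The weak gradient identity thus never has to be checked separately from an approximation.
-/
theorem HasSobolevGradientZero.of_approx (hΩ : volume Ω < ⊤) (hp : 1 ≤ p)
    (hu : MemLp u (ENNReal.ofReal p) (volume.restrict Ω))
    (hG : MemLp G (ENNReal.ofReal p) (volume.restrict Ω))
    (h : ∃ φ : ℕ → EuclideanSpace ℝ (Fin N) → ℝ, (∀ n, IsTestFunction Ω (φ n)) ∧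
      Tendsto (fun n => eLpNorm (fun x => φ n x - u x) (ENNReal.ofReal p) (volume.restrict Ω))
        atTop (𝓝 0) ∧
      Tendsto (fun n => eLpNorm (fun x => gradient (φ n) x - G x) (ENNReal.ofReal p)
        (volume.restrict Ω)) atTop (𝓝 0)) : HasSobolevGradientZero Ω p u G := by
  refine ⟨⟨hu, hG, fun ψ hψ => ?_⟩, h⟩
  obtain ⟨φ, hφ, hφu, hφG⟩ := h
  have : IsFiniteMeasure (volume.restrict Ω) := ⟨by simpa using hΩ⟩
  have hp1 : 1 ≤ ENNReal.ofReal p := by simpa using hp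
  have h1 := tendsto_eLpNorm_zero_of_le hp1
    (fun n => ((hφ n).memLp (ENNReal.ofReal p) _).1.sub hu.1) hφu one_ne_zero
  have h2 := tendsto_eLpNorm_zero_of_le hp1
    (fun n => ((hφ n).memLp_gradient (ENNReal.ofReal p) _).1.sub hG.1) hφG one_ne_zero
  have l1 := tendsto_integral_smul_of_tendsto_eLpNorm_one
    (hψ.memLp_gradient ⊤ (volume.restrict Ω))
    (fun n => memLp_one_iff_integrable.1 ((hφ n).memLp 1 _))
    (hu.integrable hp1) h1
  have l2 : Tendsto (fun n => ∫ x in Ω, ψ x • gradient (φ n) x) atTop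
      (𝓝 (∫ x in Ω, ψ x • G x)) := by
    refine tendsto_integral_of_L1' _ (hψ.smooth.continuous.aestronglyMeasurable.smul hG.1)
      (Eventually.of_forall fun n => (memLp_one_iff_integrable.1
        ((hφ n).memLp_gradient 1 _)).smul_of_top_right (hψ.memLp ⊤ _)) ?_
    have h3 := ENNReal.Tendsto.const_mul (a := eLpNorm ψ ⊤ (volume.restrict Ω)) h2
      (Or.inr (hψ.memLp ⊤ _).2.ne)
    rw [mul_zero] at h3
    refine tendsto_of_tendsto_of_tendsto_of_le_of_le tendsto_const_nhds h3 (fun _ => zero_le)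
      fun n => ?_
    refine le_trans (le_of_eq ?_) (eLpNorm_smul_le_eLpNorm_top_mul_eLpNorm 1
      (((hφ n).memLp_gradient 1 _).1.sub (hG.1)) ψ)
    refine congrArg (fun w => eLpNorm w 1 (volume.restrict Ω)) ?_
    ext1 x
    simp [smul_sub]
  refine tendsto_nhds_unique l1 (l2.neg.congr fun n => ?_)
  exact ((hφ n).integral_smul_gradient hψ).symm

end

/-! ### Chain rule and limits in `W^{1,p}_0` -/

section

variable {N : ℕ} {Ω : Set (EuclideanSpace ℝ (Fin N))} {p : ℝ}
  {u : EuclideanSpace ℝ (Fin N) → ℝ} {G : EuclideanSpace ℝ (Fin N) → EuclideanSpace ℝ (Fin N)}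

theorem HasSobolevGradientZero.congr {v : EuclideanSpace ℝ (Fin N) → ℝ}
    (h : HasSobolevGradientZero Ω p u G) (huv : u =ᵐ[volume.restrict Ω] v) :
    HasSobolevGradientZero Ω p v G := by
  refine ⟨⟨h.memLp.ae_eq huv, h.memLp_grad, fun φ hφ => ?_⟩, ?_⟩
  · rw [← h.integral_eq φ hφ]
    refine integral_congr_ae ?_
    filter_upwards [huv] with x hx
    rw [hx]
  · obtain ⟨φ, h1, h2, h3⟩ := h.exists_approx
    refine ⟨φ, h1, h2.congr fun n => eLpNorm_congr_ae ?_, h3⟩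
    filter_upwards [huv] with x hx
    rw [hx]

/-- An approximating sequence that converges almost everywhere. -/
theorem HasSobolevGradientZero.exists_approx_ae (h : HasSobolevGradientZero Ω p u G)
    (hp : 0 < p) :
    ∃ φ : ℕ → EuclideanSpace ℝ (Fin N) → ℝ, (∀ n, IsTestFunction Ω (φ n)) ∧
      Tendsto (fun n => eLpNorm (fun x => φ n x - u x) (ENNReal.ofReal p) (volume.restrict Ω))
        atTop (𝓝 0) ∧
      Tendsto (fun n => eLpNorm (fun x => gradient (φ n) x - G x) (ENNReal.ofReal p)
        (volume.restrict Ω)) atTop (𝓝 0) ∧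
      ∀ᵐ x ∂(volume.restrict Ω), Tendsto (fun n => φ n x) atTop (𝓝 (u x)) := by
  obtain ⟨φ, h1, h2, h3⟩ := h.exists_approx
  obtain ⟨ns, hns, hae⟩ := (tendstoInMeasure_of_tendsto_eLpNorm (by simpa using hp)
    (fun n => ((h1 n).memLp (ENNReal.ofReal p) _).1) h.memLp.1 h2).exists_seq_tendsto_ae
  exact ⟨fun n => φ (ns n), fun n => h1 _, h2.comp hns.tendsto_atTop,
    h3.comp hns.tendsto_atTop, hae⟩

theorem IsTestFunction.comp {φ : EuclideanSpace ℝ (Fin N) → ℝ} (hφ : IsTestFunction Ω φ)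
    {f : ℝ → ℝ} (hf : ContDiff ℝ ∞ f) (hf0 : f 0 = 0) :
    IsTestFunction Ω (fun x => f (φ x)) := by
  refine ⟨hf.comp hφ.smooth, hφ.hasCompactSupport.comp_left hf0, ?_⟩
  refine subset_trans (closure_mono fun x hx => ?_) hφ.tsupport_subset
  intro h0
  exact hx (by simp [h0, hf0])

theorem gradient_comp_real {φ : EuclideanSpace ℝ (Fin N) → ℝ} {f : ℝ → ℝ}
    {x : EuclideanSpace ℝ (Fin N)} (hf : DifferentiableAt ℝ f (φ x))
    (hφ : DifferentiableAt ℝ φ x) :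
    gradient (fun y => f (φ y)) x = deriv f (φ x) • gradient φ x := by
  have h := (hf.hasDerivAt.comp_hasFDerivAt x hφ.hasFDerivAt).fderiv
  change fderiv ℝ (fun y => f (φ y)) x = _ at h
  simp [gradient, h]

/-- The error splits as `f'(φ_n) (∇φ_n - G) + (f'(φ_n) - f'(u)) G`. The first term is controlled by
`|f'| ≤ 1`, the second by dominated convergence along an a.e. convergent approximation. -/
theorem HasSobolevGradientZero.comp (h : HasSobolevGradientZero Ω p u G) (hΩ : volume Ω < ⊤)
    (hp : 1 ≤ p) {f : ℝ → ℝ} (hf : ContDiff ℝ ∞ f) (hf0 : f 0 = 0)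
    (hf' : ∀ t, ‖deriv f t‖ ≤ 1) :
    HasSobolevGradientZero Ω p (fun x => f (u x)) (fun x => deriv f (u x) • G x) := by
  obtain ⟨φ, h1, h2, h3, h4⟩ := h.exists_approx_ae (by linarith)
  have hp0 : 0 < p := by linarith
  have hdf : Differentiable ℝ f := hf.differentiable (by simp)
  have hcd : Continuous (deriv f) := hf.continuous_deriv (by simp)
  have hlip : ∀ s t, ‖f s - f t‖ ≤ ‖s - t‖ := fun s t => by
    simpa using Convex.norm_image_sub_le_of_norm_deriv_le (𝕜 := ℝ) (C := 1)
      (fun x _ => hdf x) (fun x _ => hf' x) convex_univ (Set.mem_univ t) (Set.mem_univ s)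
  have hum : AEStronglyMeasurable (fun x => f (u x)) (volume.restrict Ω) :=
    hf.continuous.comp_aestronglyMeasurable h.memLp.1
  have hGm : AEStronglyMeasurable (fun x => deriv f (u x) • G x) (volume.restrict Ω) :=
    (hcd.comp_aestronglyMeasurable h.memLp.1).smul h.memLp_grad.1
  refine HasSobolevGradientZero.of_approx hΩ hp
    (h.memLp.mono hum (ae_of_all _ fun x => ?_))
    (h.memLp_grad.mono hGm (ae_of_all _ fun x => ?_))
    ⟨fun n x => f (φ n x), fun n => (h1 n).comp hf hf0, ?_, ?_⟩
  · simpa [hf0] using hlip (u x) 0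
  · rw [norm_smul]
    exact mul_le_of_le_one_left (norm_nonneg _) (hf' _)
  · exact tendsto_of_tendsto_of_tendsto_of_le_of_le tendsto_const_nhds h2 (fun _ => zero_le)
      fun n => eLpNorm_mono fun x => hlip _ _
  · have hA : ∀ n, AEStronglyMeasurable (fun x => gradient (φ n) x - G x) (volume.restrict Ω) :=
      fun n => ((h1 n).memLp_gradient (ENNReal.ofReal p) _).1.sub h.memLp_grad.1
    have hD : ∀ n, AEStronglyMeasurable (fun x => deriv f (φ n x)) (volume.restrict Ω) :=
      fun n => hcd.comp_aestronglyMeasurable ((h1 n).memLp (ENNReal.ofReal p) _).1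
    have hB : ∀ n, AEStronglyMeasurable (fun x => (deriv f (φ n x) - deriv f (u x)) • G x)
        (volume.restrict Ω) := fun n =>
      ((hD n).sub (hcd.comp_aestronglyMeasurable h.memLp.1)).smul h.memLp_grad.1
    have hB0 := tendsto_eLpNorm_zero_of_dominated hp0 hB (h.memLp_grad.norm.const_mul 2)
      (fun n => ae_of_all _ fun x => by
        rw [norm_smul]
        refine mul_le_mul_of_nonneg_right ((norm_sub_le _ _).trans ?_) (norm_nonneg _)
        linarith [hf' (φ n x), hf' (u x)])
      (by
        filter_upwards [h4] with x hx
        have := (((hcd.tendsto (u x)).comp hx).sub_const (deriv f (u x))).smul_const (G x)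
        simpa using this)
    have hsum := h3.add hB0
    rw [add_zero] at hsum
    refine tendsto_of_tendsto_of_tendsto_of_le_of_le tendsto_const_nhds hsum (fun _ => zero_le)
      fun n => ?_
    have heq : (fun x => gradient (fun y => f (φ n y)) x - deriv f (u x) • G x) =
        (fun x => deriv f (φ n x) • (gradient (φ n) x - G x)) +
          fun x => (deriv f (φ n x) - deriv f (u x)) • G x := by
      ext1 x
      rw [gradient_comp_real (hdf _) ((h1 n).smooth.differentiable (by simp) x)]
      simp only [Pi.add_apply, smul_sub, sub_smul]
      abel
    change eLpNorm (fun x => gradient (fun y => f (φ n y)) x - deriv f (u x) • G x) _ _ ≤ _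
    rw [heq]
    refine (eLpNorm_add_le ((hD n).smul (hA n)) (hB n) (by simpa using hp)).trans ?_
    refine add_le_add_left (eLpNorm_mono fun x => ?_) _
    rw [Pi.smul_apply', norm_smul]
    exact mul_le_of_le_one_left (norm_nonneg _) (hf' _)

/-- A diagonal choice: a test function within `1 / (n + 1)` of the `n`-th term approximates the
limit. -/
theorem HasSobolevGradientZero.of_tendsto (hΩ : volume Ω < ⊤) (hp : 1 ≤ p)
    {w : ℕ → EuclideanSpace ℝ (Fin N) → ℝ}
    {H : ℕ → EuclideanSpace ℝ (Fin N) → EuclideanSpace ℝ (Fin N)}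
    (hw : ∀ n, HasSobolevGradientZero Ω p (w n) (H n))
    (hu : MemLp u (ENNReal.ofReal p) (volume.restrict Ω))
    (hG : MemLp G (ENNReal.ofReal p) (volume.restrict Ω))
    (hwu : Tendsto (fun n => eLpNorm (fun x => w n x - u x) (ENNReal.ofReal p)
      (volume.restrict Ω)) atTop (𝓝 0))
    (hHG : Tendsto (fun n => eLpNorm (fun x => H n x - G x) (ENNReal.ofReal p)
      (volume.restrict Ω)) atTop (𝓝 0)) : HasSobolevGradientZero Ω p u G := by
  have hp1 : 1 ≤ ENNReal.ofReal p := by simpa using hp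
  have hε : ∀ n : ℕ, (0 : ℝ≥0∞) < ((n : ℝ≥0∞) + 1)⁻¹ := fun n => by simp
  have hex : ∀ n, ∃ φ : EuclideanSpace ℝ (Fin N) → ℝ, IsTestFunction Ω φ ∧
      eLpNorm (fun x => φ x - w n x) (ENNReal.ofReal p) (volume.restrict Ω) ≤
        ((n : ℝ≥0∞) + 1)⁻¹ ∧
      eLpNorm (fun x => gradient φ x - H n x) (ENNReal.ofReal p) (volume.restrict Ω) ≤
        ((n : ℝ≥0∞) + 1)⁻¹ := fun n => by
    obtain ⟨φ, h1, h2, h3⟩ := (hw n).exists_approx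
    obtain ⟨k, hk1, hk2⟩ :=
      ((h2.eventually_le_const (hε n)).and (h3.eventually_le_const (hε n))).exists
    exact ⟨φ k, h1 k, hk1, hk2⟩
  choose φ hφ hφ1 hφ2 using hex
  have hlim : Tendsto (fun n : ℕ => ((n : ℝ≥0∞) + 1)⁻¹) atTop (𝓝 0) := by
    have := (tendsto_add_atTop_iff_nat 1).2 ENNReal.tendsto_inv_nat_nhds_zero
    simpa using this
  refine HasSobolevGradientZero.of_approx hΩ hp hu hG ⟨φ, hφ, ?_, ?_⟩
  · have h := hlim.add hwu
    rw [add_zero] at h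
    refine tendsto_of_tendsto_of_tendsto_of_le_of_le tendsto_const_nhds h (fun _ => zero_le)
      fun n => ?_
    refine le_trans (le_of_eq ?_) ((eLpNorm_add_le (((hφ n).memLp (ENNReal.ofReal p) _).1.sub
      (hw n).memLp.1) ((hw n).memLp.1.sub hu.1) hp1).trans (add_le_add_left (hφ1 n) _))
    exact congrArg (fun f => eLpNorm f _ _) (by ext1 x; simp)
  · have h := hlim.add hHG
    rw [add_zero] at h
    refine tendsto_of_tendsto_of_tendsto_of_le_of_le tendsto_const_nhds h (fun _ => zero_le)
      fun n => ?_
    refine le_trans (le_of_eq ?_) ((eLpNorm_add_le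
      (((hφ n).memLp_gradient (ENNReal.ofReal p) _).1.sub
      (hw n).memLp_grad.1) ((hw n).memLp_grad.1.sub hG.1) hp1).trans (add_le_add_left (hφ2 n) _))
    exact congrArg (fun f => eLpNorm f _ _) (by ext1 x; simp)

end

/-! ### Truncations `(u - k)^+` -/

/-- A smooth approximation, with derivative in `[0, 1]`, of the positive part of `t - k`. -/
noncomputable def smoothPosPart (k : ℝ) (n : ℕ) (t : ℝ) : ℝ :=
  ∫ s in (0 : ℝ)..t, Real.smoothTransition (n * (s - k))

theorem continuous_smoothTransition_mul_sub (k : ℝ) (n : ℕ) :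
    Continuous fun s : ℝ => Real.smoothTransition (n * (s - k)) :=
  Real.smoothTransition.continuous.comp (by fun_prop)

theorem hasDerivAt_smoothPosPart (k : ℝ) (n : ℕ) (t : ℝ) :
    HasDerivAt (smoothPosPart k n) (Real.smoothTransition (n * (t - k))) t :=
  intervalIntegral.integral_hasDerivAt_right
    ((continuous_smoothTransition_mul_sub k n).intervalIntegrable _ _)
    (continuous_smoothTransition_mul_sub k n).stronglyMeasurable.stronglyMeasurableAtFilter
    (continuous_smoothTransition_mul_sub k n).continuousAt

theorem deriv_smoothPosPart (k : ℝ) (n : ℕ) :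
    deriv (smoothPosPart k n) = fun t => Real.smoothTransition (n * (t - k)) :=
  funext fun t => (hasDerivAt_smoothPosPart k n t).deriv

theorem contDiff_smoothPosPart (k : ℝ) (n : ℕ) : ContDiff ℝ ∞ (smoothPosPart k n) := by
  rw [contDiff_infty_iff_deriv]
  refine ⟨fun t => (hasDerivAt_smoothPosPart k n t).differentiableAt, ?_⟩
  rw [deriv_smoothPosPart]
  exact Real.smoothTransition.contDiff.comp (by fun_prop)

/-- Convergence holds at every point, including `t = k`, where the transition is `0`. Hence the
indicator of `u > k` appears in the limit gradient without knowing that `G` vanishes on `{u = k}`.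
-/
theorem tendsto_smoothTransition_mul_sub (k t : ℝ) :
    Tendsto (fun n : ℕ => Real.smoothTransition (n * (t - k))) atTop
      (𝓝 (if k < t then 1 else 0)) := by
  split_ifs with h
  · have h1 : Tendsto (fun n : ℕ => (n : ℝ) * (t - k)) atTop atTop :=
      tendsto_natCast_atTop_atTop.atTop_mul_const (sub_pos.2 h)
    refine tendsto_const_nhds.congr' ?_
    filter_upwards [h1.eventually_ge_atTop 1] with n hn
    exact (Real.smoothTransition.one_of_one_le hn).symm
  · refine tendsto_const_nhds.congr fun n => (Real.smoothTransition.zero_of_nonpos ?_).symm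
    exact mul_nonpos_of_nonneg_of_nonpos n.cast_nonneg (sub_nonpos.2 (not_lt.1 h))

/-- Dominated convergence under the integral; `k ≥ 0` puts the base point `0` where the limit
integrand contributes nothing. -/
theorem tendsto_smoothPosPart {k : ℝ} (hk : 0 ≤ k) (t : ℝ) :
    Tendsto (fun n => smoothPosPart k n t) atTop (𝓝 (max (t - k) 0)) := by
  have h1 : Tendsto (fun n => smoothPosPart k n t) atTop
      (𝓝 (∫ s in (0 : ℝ)..t, if k < s then (1 : ℝ) else 0)) := by
    refine intervalIntegral.tendsto_integral_filter_of_dominated_convergence (fun _ => 1)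
      (Eventually.of_forall fun n =>
        (continuous_smoothTransition_mul_sub k n).aestronglyMeasurable)
      (Eventually.of_forall fun n => ae_of_all _ fun s _ => ?_) intervalIntegrable_const
      (ae_of_all _ fun s _ => tendsto_smoothTransition_mul_sub k s)
    rw [Real.norm_of_nonneg (Real.smoothTransition.nonneg _)]
    exact Real.smoothTransition.le_one _
  have h2 : ∫ s in (0 : ℝ)..t, (if k < s then (1 : ℝ) else 0) = max (t - k) 0 := by
    have hi : (fun s : ℝ => if k < s then (1 : ℝ) else 0) = (Set.Ioi k).indicator 1 := by
      ext s; simp [Set.indicator_apply]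
    rw [hi]
    rcases le_total t 0 with ht | ht
    · rw [max_eq_right (by linarith), intervalIntegral.integral_of_ge ht,
        setIntegral_eq_zero_of_forall_eq_zero, neg_zero]
      intro s hs
      exact Set.indicator_of_notMem (fun h : k < s => by linarith [hs.2]) _
    · rw [intervalIntegral.integral_of_le ht, setIntegral_indicator measurableSet_Ioi]
      have : Set.Ioc 0 t ∩ Set.Ioi k = Set.Ioc k t := by
        ext s; simp only [Set.mem_inter_iff, Set.mem_Ioc, Set.mem_Ioi]
        constructor
        · rintro ⟨⟨_, h⟩, h'⟩; exact ⟨h', h⟩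
        · rintro ⟨h', h⟩; exact ⟨⟨by linarith, h⟩, h'⟩
      rw [this]
      simp [Measure.real, ENNReal.toReal_ofReal']
  rwa [h2] at h1

section

variable {N : ℕ} {Ω : Set (EuclideanSpace ℝ (Fin N))} {p : ℝ}
  {u : EuclideanSpace ℝ (Fin N) → ℝ} {G : EuclideanSpace ℝ (Fin N) → EuclideanSpace ℝ (Fin N)}

/-- The truncation `(u - k)^+` of a function `u` in `W^{1,p}_0(Ω)`, for a level `k ≥ 0`. -/
theorem HasSobolevGradientZero.posPart_sub (h : HasSobolevGradientZero Ω p u G)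
    (hΩ : volume Ω < ⊤) (hp : 1 ≤ p) {k : ℝ} (hk : 0 ≤ k) :
    HasSobolevGradientZero Ω p (fun x => max (u x - k) 0)
      (fun x => (if k < u x then (1 : ℝ) else 0) • G x) := by
  have hp0 : 0 < p := by linarith
  have hf' : ∀ n t, ‖deriv (smoothPosPart k n) t‖ ≤ 1 := fun n t => by
    rw [deriv_smoothPosPart, Real.norm_of_nonneg (Real.smoothTransition.nonneg _)]
    exact Real.smoothTransition.le_one _
  have h0 : ∀ n, smoothPosPart k n 0 = 0 := fun n => by simp [smoothPosPart]
  have hlip : ∀ n t, ‖smoothPosPart k n t‖ ≤ ‖t‖ := fun n t => by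
    simpa [h0] using Convex.norm_image_sub_le_of_norm_deriv_le (𝕜 := ℝ) (C := 1)
      (fun x _ => (hasDerivAt_smoothPosPart k n x).differentiableAt) (fun x _ => hf' n x)
      convex_univ (Set.mem_univ (0 : ℝ)) (Set.mem_univ t)
  have hw := fun n => h.comp hΩ hp (contDiff_smoothPosPart k n) (h0 n) (hf' n)
  have hmax : ∀ t : ℝ, ‖max (t - k) 0‖ ≤ ‖t‖ := fun t => by
    rw [Real.norm_of_nonneg (le_max_right _ _)]
    exact max_le ((by linarith : t - k ≤ t).trans (le_abs_self t)) (abs_nonneg t)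
  have hind : ∀ t : ℝ, ‖if k < t then (1 : ℝ) else 0‖ ≤ 1 := fun t => by
    split_ifs <;> simp
  have hum : MemLp (fun x => max (u x - k) 0) (ENNReal.ofReal p) (volume.restrict Ω) :=
    h.memLp.mono ((by fun_prop : Continuous fun t : ℝ => max (t - k) 0).comp_aestronglyMeasurable
      h.memLp.1) (ae_of_all _ fun x => hmax _)
  have hGm : MemLp (fun x => (if k < u x then (1 : ℝ) else 0) • G x) (ENNReal.ofReal p)
      (volume.restrict Ω) := by
    refine h.memLp_grad.mono (AEStronglyMeasurable.fun_smul ?_ h.memLp_grad.1)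
      (ae_of_all _ fun x => ?_)
    · have : Measurable fun t : ℝ => if k < t then (1 : ℝ) else 0 :=
        Measurable.ite measurableSet_Ioi measurable_const measurable_const
      exact (this.comp_aemeasurable h.memLp.1.aemeasurable).aestronglyMeasurable
    · rw [norm_smul]
      exact mul_le_of_le_one_left (norm_nonneg _) (hind _)
  refine HasSobolevGradientZero.of_tendsto hΩ hp hw hum hGm ?_ ?_
  · refine tendsto_eLpNorm_zero_of_dominated hp0 (fun n => (hw n).memLp.1.sub hum.1)
      (h.memLp.norm.const_mul 2) (fun n => ae_of_all _ fun x => ?_) (ae_of_all _ fun x => ?_)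
    · refine (norm_sub_le _ _).trans ?_
      linarith [hlip n (u x), hmax (u x)]
    · simpa using (tendsto_smoothPosPart hk (u x)).sub_const (max (u x - k) 0)
  · refine tendsto_eLpNorm_zero_of_dominated hp0 (fun n => (hw n).memLp_grad.1.sub hGm.1)
      (h.memLp_grad.norm.const_mul 2) (fun n => ae_of_all _ fun x => ?_)
      (ae_of_all _ fun x => ?_)
    · rw [← sub_smul, norm_smul]
      refine mul_le_mul_of_nonneg_right ((norm_sub_le _ _).trans ?_) (norm_nonneg _)
      linarith [hf' n (u x), hind (u x)]
    · have := ((tendsto_smoothTransition_mul_sub k (u x)).smul_const (G x)).sub_const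
        ((if k < u x then (1 : ℝ) else 0) • G x)
      simpa [deriv_smoothPosPart] using this

end

/-! ### Sobolev inequality in `W^{1,p}_0` and testing the equation -/

section

variable {N : ℕ} {Ω : Set (EuclideanSpace ℝ (Fin N))} {p : ℝ}
  {u : EuclideanSpace ℝ (Fin N) → ℝ} {G : EuclideanSpace ℝ (Fin N) → EuclideanSpace ℝ (Fin N)}

/-- A Sobolev inequality for test functions extends to `W^{1,p}_0(Ω)`. -/
theorem HasSobolevGradientZero.eLpNorm_le (h : HasSobolevGradientZero Ω p u G)
    (hΩ : volume Ω < ⊤) (hp : 1 ≤ p) {S : ℝ} {p₁ q₁ : ℝ≥0∞} (hp₁ : 1 ≤ p₁)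
    (hp₁p : p₁ ≤ ENNReal.ofReal p)
    (hS : ∀ φ : EuclideanSpace ℝ (Fin N) → ℝ, ContDiff ℝ 1 φ → HasCompactSupport φ →
      eLpNorm φ q₁ volume ≤ ENNReal.ofReal S * eLpNorm (gradient φ) p₁ volume) :
    eLpNorm u q₁ (volume.restrict Ω) ≤
      ENNReal.ofReal S * eLpNorm G p₁ (volume.restrict Ω) := by
  have : IsFiniteMeasure (volume.restrict Ω) := ⟨by simpa using hΩ⟩
  obtain ⟨φ, h1, -, h3, h4⟩ := h.exists_approx_ae (by linarith)
  have hA : ∀ n, AEStronglyMeasurable (fun x => gradient (φ n) x - G x) (volume.restrict Ω) :=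
    fun n => ((h1 n).memLp_gradient (ENNReal.ofReal p) _).1.sub h.memLp_grad.1
  have h5 := tendsto_eLpNorm_zero_of_le hp₁p hA h3 (zero_lt_one.trans_le hp₁).ne'
  have h6 : ∀ n, eLpNorm (φ n) q₁ (volume.restrict Ω) ≤ ENNReal.ofReal S *
      (eLpNorm (fun x => gradient (φ n) x - G x) p₁ (volume.restrict Ω) +
        eLpNorm G p₁ (volume.restrict Ω)) := fun n => by
    calc eLpNorm (φ n) q₁ (volume.restrict Ω) ≤ eLpNorm (φ n) q₁ volume :=
          eLpNorm_mono_measure _ Measure.restrict_le_self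
      _ ≤ ENNReal.ofReal S * eLpNorm (gradient (φ n)) p₁ volume :=
          hS _ ((h1 n).smooth.of_le (by simp)) (h1 n).hasCompactSupport
      _ = ENNReal.ofReal S * eLpNorm (gradient (φ n)) p₁ (volume.restrict Ω) := by
          rw [eLpNorm_restrict_eq_of_support_subset]
          intro x hx
          by_contra hxΩ
          exact hx ((h1 n).gradient_eq_zero_of_notMem hxΩ)
      _ ≤ _ := by
          gcongr
          have := eLpNorm_add_le (hA n) h.memLp_grad.1 hp₁
          refine le_trans (le_of_eq ?_) this
          exact congrArg (fun f => eLpNorm f _ _) (by ext1 x; simp)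
  have h7 : Tendsto (fun n => ENNReal.ofReal S *
      (eLpNorm (fun x => gradient (φ n) x - G x) p₁ (volume.restrict Ω) +
        eLpNorm G p₁ (volume.restrict Ω))) atTop
      (𝓝 (ENNReal.ofReal S * eLpNorm G p₁ (volume.restrict Ω))) := by
    have := ENNReal.Tendsto.const_mul (a := ENNReal.ofReal S)
      (h5.add_const (eLpNorm G p₁ (volume.restrict Ω))) (Or.inr ENNReal.ofReal_ne_top)
    rwa [zero_add] at this
  -- Fatou's lemma: only a.e. convergence of `φ n` is available in the exponent `q₁`.
  calc _ ≤ atTop.liminf fun n => eLpNorm (φ n) q₁ (volume.restrict Ω) :=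
        Lp.eLpNorm_lim_le_liminf_eLpNorm
          (fun n => ((h1 n).memLp (ENNReal.ofReal p) _).1) _ h4
    _ ≤ atTop.liminf fun n => ENNReal.ofReal S *
      (eLpNorm (fun x => gradient (φ n) x - G x) p₁ (volume.restrict Ω) +
        eLpNorm G p₁ (volume.restrict Ω)) := liminf_le_liminf (Eventually.of_forall h6)
    _ = _ := h7.liminf_eq

/-- The Sobolev inequality in terms of the measure of a set `A` off which `u` vanishes. -/
theorem HasSobolevGradientZero.eLpNorm_le_of_support (h : HasSobolevGradientZero Ω p u G)
    (hΩ : volume Ω < ⊤) (hp : 1 ≤ p) {S q : ℝ} {p₁ q₁ : ℝ≥0∞} (hp₁ : 1 ≤ p₁)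
    (hp₁p : p₁ ≤ ENNReal.ofReal p) (hq : 0 < q) (hqq₁ : ENNReal.ofReal q ≤ q₁)
    (hpq₁ : 1 / p₁.toReal - 1 / q₁.toReal = 1 / N)
    (hS : ∀ φ : EuclideanSpace ℝ (Fin N) → ℝ, ContDiff ℝ 1 φ → HasCompactSupport φ →
      eLpNorm φ q₁ volume ≤ ENNReal.ofReal S * eLpNorm (gradient φ) p₁ volume)
    {A : Set (EuclideanSpace ℝ (Fin N))} (hA : MeasurableSet A)
    (huA : ∀ x, x ∉ A → u x = 0) (hGA : ∀ x, x ∉ A → G x = 0) :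
    eLpNorm u (ENNReal.ofReal q) (volume.restrict Ω) ≤ ENNReal.ofReal S *
      volume.restrict Ω A ^ (1 / q - 1 / p + 1 / N) *
        eLpNorm G (ENNReal.ofReal p) (volume.restrict Ω) := by
  have hp0 : 0 < p := by linarith
  have hu : A.indicator u = u := Set.indicator_eq_self.2 fun x hx => by
    by_contra hxA; exact hx (huA x hxA)
  have hG : A.indicator G = G := Set.indicator_eq_self.2 fun x hx => by
    by_contra hxA; exact hx (hGA x hxA)
  have hur : ∀ r, eLpNorm u r (volume.restrict Ω) = eLpNorm u r ((volume.restrict Ω).restrict A) :=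
    fun r => by rw [← eLpNorm_indicator_eq_eLpNorm_restrict hA, hu]
  have hGr : ∀ r, eLpNorm G r (volume.restrict Ω) = eLpNorm G r ((volume.restrict Ω).restrict A) :=
    fun r => by rw [← eLpNorm_indicator_eq_eLpNorm_restrict hA, hG]
  have h1 := eLpNorm_le_eLpNorm_mul_rpow_measure_univ (μ := (volume.restrict Ω).restrict A)
    hqq₁ h.memLp.1.restrict
  have h2 := eLpNorm_le_eLpNorm_mul_rpow_measure_univ (μ := (volume.restrict Ω).restrict A)
    hp₁p h.memLp_grad.1.restrict
  have h3 := h.eLpNorm_le hΩ hp hp₁ hp₁p hS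
  rw [← hur, ← hur, Measure.restrict_apply_univ, ENNReal.toReal_ofReal hq.le] at h1
  rw [← hGr, ← hGr, Measure.restrict_apply_univ, ENNReal.toReal_ofReal hp0.le] at h2
  have e1 : 0 ≤ 1 / q - 1 / q₁.toReal := by
    rcases eq_or_ne q₁ ⊤ with rfl | hs
    · simpa using hq.le
    · have := (ENNReal.ofReal_le_iff_le_toReal hs).1 hqq₁
      linarith [one_div_le_one_div_of_le hq this]
  have e2 : 0 ≤ 1 / p₁.toReal - 1 / p := by
    have a1 : p₁.toReal ≤ p := ENNReal.toReal_le_of_le_ofReal hp0.le hp₁p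
    have a2 : 0 < p₁.toReal := ENNReal.toReal_pos (zero_lt_one.trans_le hp₁).ne'
      (ne_top_of_le_ne_top ENNReal.ofReal_ne_top hp₁p)
    linarith [one_div_le_one_div_of_le a2 a1]
  -- The power of the measure collects two Hölder gains, from `q₁` down to `q` for `u` and from `p`
  -- down to `p₁` for `G`.
  have e3 : 1 / q - 1 / p + 1 / (N : ℝ) = (1 / q - 1 / q₁.toReal) + (1 / p₁.toReal - 1 / p) := by
    rw [← hpq₁]; ring
  rw [e3, ENNReal.rpow_add_of_nonneg _ _ e1 e2]
  set m := volume.restrict Ω A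
  calc _ ≤ _ := h1
    _ ≤ (ENNReal.ofReal S * (eLpNorm G (ENNReal.ofReal p) (volume.restrict Ω) *
          m ^ (1 / p₁.toReal - 1 / p))) * m ^ (1 / q - 1 / q₁.toReal) := by
        gcongr
        exact h3.trans (by gcongr)
    _ = _ := by ring

theorem HasSobolevGradientZero.memLp_of_le (h : HasSobolevGradientZero Ω p u G)
    (hΩ : volume Ω < ⊤) (hp : 1 ≤ p) {S : ℝ} {p₁ q₁ r : ℝ≥0∞} (hp₁ : 1 ≤ p₁)
    (hp₁p : p₁ ≤ ENNReal.ofReal p) (hr : r ≤ q₁)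
    (hS : ∀ φ : EuclideanSpace ℝ (Fin N) → ℝ, ContDiff ℝ 1 φ → HasCompactSupport φ →
      eLpNorm φ q₁ volume ≤ ENNReal.ofReal S * eLpNorm (gradient φ) p₁ volume) :
    MemLp u r (volume.restrict Ω) := by
  have : IsFiniteMeasure (volume.restrict Ω) := ⟨by simpa using hΩ⟩
  have h1 : MemLp u q₁ (volume.restrict Ω) := ⟨h.memLp.1,
    (h.eLpNorm_le hΩ hp hp₁ hp₁p hS).trans_lt
      (ENNReal.mul_lt_top ENNReal.ofReal_lt_top (h.memLp_grad.mono_exponent hp₁p).2)⟩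
  exact h1.mono_exponent hr

/-- Testing the Lane-Emden equation with `(u - k)^+`. -/
theorem HasSobolevGradientZero.toReal_eLpNorm_truncation_rpow {q lam : ℝ}
    (h : HasSobolevGradientZero Ω p u G) (hΩ : volume Ω < ⊤) (hp : 1 < p)
    (heq : ∀ (φ : EuclideanSpace ℝ (Fin N) → ℝ)
      (H : EuclideanSpace ℝ (Fin N) → EuclideanSpace ℝ (Fin N)),
      HasSobolevGradientZero Ω p φ H →
        ∫ x in Ω, inner ℝ (‖G x‖ ^ (p - 2) • G x) (H x) =
          lam * ∫ x in Ω, |u x| ^ (q - 2) * u x * φ x) {k : ℝ} (hk : 0 ≤ k) :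
    (eLpNorm (fun x => (if k < u x then (1 : ℝ) else 0) • G x) (ENNReal.ofReal p)
      (volume.restrict Ω)).toReal ^ p =
      lam * ∫ x in Ω, |u x| ^ (q - 2) * u x * max (u x - k) 0 := by
  have hp0 : 0 < p := by linarith
  have ht := h.posPart_sub hΩ hp.le hk
  rw [← heq _ _ ht, toReal_eLpNorm ht.memLp_grad.1,
    lpNorm_eq_integral_norm_rpow_toReal (by simpa using hp0) ENNReal.ofReal_ne_top ht.memLp_grad.1,
    ENNReal.toReal_ofReal hp0.le, ← Real.rpow_mul, inv_mul_cancel₀ hp0.ne', Real.rpow_one]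
  · refine integral_congr_ae (ae_of_all _ fun x => ?_)
    simp only
    split_ifs
    -- Merging `‖G‖^(p-2)` with `‖G‖^2` needs a nonzero base, since `p - 2` may be negative.
    · rcases eq_or_ne (G x) 0 with h0 | h0
      · simp [h0, Real.zero_rpow hp0.ne']
      · rw [one_smul, real_inner_smul_left, real_inner_self_eq_norm_sq, ← Real.rpow_natCast,
          ← Real.rpow_add (norm_pos_iff.2 h0)]
        norm_num
    · simp [Real.zero_rpow hp0.ne']
  · exact integral_nonneg fun x => by positivity

end

/-! ### Elementary inequalities for the iteration -/

/-- For `t > k` one has `t ≤ k / (k - h) * (t - h)`. This keeps the estimate homogeneous, with no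
extra term in `k` and the measure of the level set. -/
theorem rpow_mul_posPart_le {q h k t : ℝ} (hq : 1 ≤ q) (hh : 0 ≤ h) (hk : h < k) :
    |t| ^ (q - 2) * t * max (t - k) 0 ≤ (k / (k - h)) ^ (q - 1) * ‖max (t - h) 0‖ ^ q := by
  have hkh : 0 < k - h := by linarith
  have hk0 : 0 < k := by linarith
  rcases le_or_gt t k with ht | ht
  · rw [max_eq_right (by linarith), mul_zero]
    positivity
  · have ht0 : 0 < t := by linarith
    have hth : 0 < t - h := by linarith
    rw [max_eq_left (by linarith), max_eq_left hth.le, Real.norm_of_nonneg hth.le, abs_of_pos ht0]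
    have e1 : t ^ (q - 2) * t = t ^ (q - 1) := by
      rw [← Real.rpow_add_one ht0.ne']; congr 1; ring
    have e2 : (t - h) ^ q = (t - h) ^ (q - 1) * (t - h) := by
      rw [← Real.rpow_add_one hth.ne']; congr 1; ring
    have e3 : t ≤ k / (k - h) * (t - h) := by
      rw [div_mul_eq_mul_div, le_div_iff₀ hkh]
      nlinarith
    rw [e1, e2, ← mul_assoc, ← Real.mul_rpow (by positivity) hth.le]
    have hq1 : 0 ≤ q - 1 := by linarith
    gcongr

/-- By induction `y n ≤ y 0 * c ^ n`: the gain `(c ^ n) ^ δ` cancels the growth `b ^ n` exactly, and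
`h0` supplies one more factor `c`. -/
theorem tendsto_zero_of_le_mul_rpow {y : ℕ → ℝ} {K b c δ : ℝ} (hy : ∀ n, 0 ≤ y n) (hK : 0 ≤ K)
    (hb : 0 ≤ b) (hδ : 0 < δ) (hc : 0 < c) (hc1 : c < 1) (hcb : c ^ δ * b = 1)
    (hrec : ∀ n, y (n + 1) ≤ K * b ^ (n + 1) * y n ^ (1 + δ)) (h0 : K * y 0 ^ δ * b ≤ c) :
    Tendsto y atTop (𝓝 0) := by
  have key : ∀ n, y n ≤ y 0 * c ^ n := by
    intro n
    induction n with
    | zero => simp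
    | succ n ih =>
      calc y (n + 1) ≤ K * b ^ (n + 1) * y n ^ (1 + δ) := hrec n
        _ ≤ K * b ^ (n + 1) * (y 0 * c ^ n) ^ (1 + δ) := by
          gcongr
          exact hy n
        _ = K * y 0 ^ δ * b * (y 0 * c ^ n) * (c ^ δ * b) ^ n := by
          have h0 := hy 0
          rw [Real.rpow_add_of_nonneg (by positivity) zero_le_one hδ.le, Real.rpow_one,
            Real.mul_rpow h0 (by positivity), mul_pow (c ^ δ), ← Real.rpow_natCast (c ^ δ),
            ← Real.rpow_natCast c, ← Real.rpow_mul hc.le, ← Real.rpow_mul hc.le, mul_comm δ,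
            pow_succ]
          ring
        _ ≤ c * (y 0 * c ^ n) * (c ^ δ * b) ^ n := by
          have h0 := hy 0
          rw [hcb, one_pow]
          gcongr
        _ = y 0 * c ^ (n + 1) := by rw [hcb]; ring
  refine squeeze_zero hy key ?_
  simpa using (tendsto_pow_atTop_nhds_zero_of_lt_one hc.le hc1).const_mul (y 0)

/-! ### De Giorgi iteration -/

section

variable {N : ℕ} {Ω : Set (EuclideanSpace ℝ (Fin N))} {p q lam S : ℝ} {p₁ q₁ : ℝ≥0∞}
  {u : EuclideanSpace ℝ (Fin N) → ℝ} {G : EuclideanSpace ℝ (Fin N) → EuclideanSpace ℝ (Fin N)}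

theorem MeasureTheory.MemLp.posPart_sub {α : Type*} {m : MeasurableSpace α} {μ : Measure α}
    [IsFiniteMeasure μ] {r : ℝ≥0∞} {f : α → ℝ} (hf : MemLp f r μ) (k : ℝ) :
    MemLp (fun x => max (f x - k) 0) r μ := by
  have h := (hf.sub (memLp_const k)).pos_part
  simpa using h

/-- The measure of a superlevel set, by Chebyshev's inequality. -/
theorem toReal_measure_lt_le {α : Type*} {m : MeasurableSpace α} {μ : Measure α}
    [IsFiniteMeasure μ] {f : α → ℝ} {h k : ℝ} (hq : 0 < q)
    (hf : MemLp f (ENNReal.ofReal q) μ) (hk : h < k) :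
    (μ {x | k < f x}).toReal ≤
      ((eLpNorm (fun x => max (f x - h) 0) (ENNReal.ofReal q) μ).toReal / (k - h)) ^ q := by
  have hkh : 0 < k - h := by linarith
  have hm := hf.posPart_sub h
  have h1 := mul_meas_ge_le_pow_eLpNorm' μ (by simpa using hq) ENNReal.ofReal_ne_top hm.1
    (ENNReal.ofReal (k - h))
  rw [ENNReal.toReal_ofReal hq.le] at h1
  have h2 : μ {x | k < f x} ≤ μ {x | ENNReal.ofReal (k - h) ≤ ‖max (f x - h) 0‖ₑ} := by
    refine measure_mono fun x (hx : k < f x) => ?_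
    change _ ≤ ‖max (f x - h) 0‖ₑ
    rw [max_eq_left (by linarith), Real.enorm_of_nonneg (by linarith)]
    exact ENNReal.ofReal_le_ofReal (by linarith)
  have h3 : ENNReal.ofReal (k - h) ^ q * μ {x | k < f x} ≤
      eLpNorm (fun x => max (f x - h) 0) (ENNReal.ofReal q) μ ^ q :=
    le_trans (by gcongr) h1
  have h4 := ENNReal.toReal_mono (ENNReal.rpow_ne_top_of_nonneg hq.le hm.2.ne) h3
  rw [ENNReal.toReal_mul, ← ENNReal.toReal_rpow, ← ENNReal.toReal_rpow,
    ENNReal.toReal_ofReal hkh.le] at h4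
  rw [Real.div_rpow ENNReal.toReal_nonneg hkh.le, le_div_iff₀ (by positivity), mul_comm]
  exact h4

theorem integral_rpow_mul_posPart_le {α : Type*} {m : MeasurableSpace α} {μ : Measure α}
    [IsFiniteMeasure μ] {f : α → ℝ} {h k : ℝ} (hq : 1 ≤ q)
    (hf : MemLp f (ENNReal.ofReal q) μ) (hh : 0 ≤ h) (hk : h < k) :
    ∫ x, |f x| ^ (q - 2) * f x * max (f x - k) 0 ∂μ ≤ (k / (k - h)) ^ (q - 1) *
      (eLpNorm (fun x => max (f x - h) 0) (ENNReal.ofReal q) μ).toReal ^ q := by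
  have hq0 : 0 < q := by linarith
  have hm := hf.posPart_sub h
  have h0 : ENNReal.ofReal q ≠ 0 := by simpa using hq0
  have hi := hm.integrable_norm_rpow h0 ENNReal.ofReal_ne_top
  rw [ENNReal.toReal_ofReal hq0.le] at hi
  have e : (eLpNorm (fun x => max (f x - h) 0) (ENNReal.ofReal q) μ).toReal ^ q =
      ∫ x, ‖max (f x - h) 0‖ ^ q ∂μ := by
    rw [toReal_eLpNorm hm.1, lpNorm_eq_integral_norm_rpow_toReal h0 ENNReal.ofReal_ne_top hm.1,
      ENNReal.toReal_ofReal hq0.le, ← Real.rpow_mul (integral_nonneg fun x => by positivity),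
      inv_mul_cancel₀ hq0.ne', Real.rpow_one]
  rw [e, ← integral_const_mul]
  refine integral_mono_of_nonneg (ae_of_all _ fun x => ?_) (hi.const_mul _)
    (ae_of_all _ fun x => rpow_mul_posPart_le hq hh hk)
  change 0 ≤ |f x| ^ (q - 2) * f x * max (f x - k) 0
  rcases le_or_gt (f x) k with hx | hx
  · rw [max_eq_right (by linarith), mul_zero]
  · have : 0 < f x := by linarith
    positivity

/-- The De Giorgi step: the norm of `(u - k)^+` in terms of that of `(u - h)^+`, for `h < k`. -/
theorem HasSobolevGradientZero.toReal_eLpNorm_posPart_le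
    (hG : HasSobolevGradientZero Ω p u G) (hu : Measurable u) (hΩ : volume Ω < ⊤) (hp : 1 < p)
    (hlam : 0 ≤ lam)
    (heq : ∀ (φ : EuclideanSpace ℝ (Fin N) → ℝ)
      (H : EuclideanSpace ℝ (Fin N) → EuclideanSpace ℝ (Fin N)),
      HasSobolevGradientZero Ω p φ H →
        ∫ x in Ω, inner ℝ (‖G x‖ ^ (p - 2) • G x) (H x) =
          lam * ∫ x in Ω, |u x| ^ (q - 2) * u x * φ x)
    (hq : 1 ≤ q) (hS0 : 0 ≤ S) (hp₁ : 1 ≤ p₁)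
    (hp₁p : p₁ ≤ ENNReal.ofReal p) (hqq₁ : ENNReal.ofReal q ≤ q₁)
    (hpq₁ : 1 / p₁.toReal - 1 / q₁.toReal = 1 / N)
    (hS : ∀ φ : EuclideanSpace ℝ (Fin N) → ℝ, ContDiff ℝ 1 φ → HasCompactSupport φ →
      eLpNorm φ q₁ volume ≤ ENNReal.ofReal S * eLpNorm (gradient φ) p₁ volume)
    (hσ : 0 ≤ 1 / q - 1 / p + 1 / N) {h k : ℝ} (hh : 0 ≤ h) (hk : h < k) :
    (eLpNorm (fun x => max (u x - k) 0) (ENNReal.ofReal q) (volume.restrict Ω)).toReal ≤ S *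
      (((eLpNorm (fun x => max (u x - h) 0) (ENNReal.ofReal q) (volume.restrict Ω)).toReal /
        (k - h)) ^ q) ^ (1 / q - 1 / p + 1 / N) *
      (lam * ((k / (k - h)) ^ (q - 1) *
        (eLpNorm (fun x => max (u x - h) 0) (ENNReal.ofReal q)
          (volume.restrict Ω)).toReal ^ q)) ^ (1 / p) := by
  have : IsFiniteMeasure (volume.restrict Ω) := ⟨by simpa using hΩ⟩
  have hp0 : 0 < p := by linarith
  have hk0 : 0 ≤ k := by linarith
  have huq : MemLp u (ENNReal.ofReal q) (volume.restrict Ω) :=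
    hG.memLp_of_le hΩ hp.le hp₁ hp₁p hqq₁ hS
  have ht := hG.posPart_sub hΩ hp.le hk0
  have h1 := ht.eLpNorm_le_of_support hΩ hp.le hp₁ hp₁p (by linarith) hqq₁ hpq₁ hS
    (A := {x | k < u x}) (measurableSet_lt measurable_const hu)
    (fun x hx => max_eq_right (by simpa using hx)) (fun x hx => by simpa using fun h => absurd h hx)
  have hA := measure_ne_top (volume.restrict Ω) {x | k < u x}
  have h2 := ENNReal.toReal_mono (ENNReal.mul_ne_top (ENNReal.mul_ne_top ENNReal.ofReal_ne_top
    (ENNReal.rpow_ne_top_of_nonneg hσ hA)) ht.memLp_grad.2.ne) h1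
  rw [ENNReal.toReal_mul, ENNReal.toReal_mul, ENNReal.toReal_ofReal hS0,
    ← ENNReal.toReal_rpow] at h2
  have h3 := toReal_measure_lt_le (by linarith) huq hk
  have h4 := hG.toReal_eLpNorm_truncation_rpow hΩ hp heq hk0
  have h5 := integral_rpow_mul_posPart_le hq huq hh hk
  -- The measure factor is bounded by Chebyshev (`h3`), the gradient factor by the tested equation
  -- (`h4`, `h5`).
  refine h2.trans ?_
  gcongr
  rw [one_div, Real.le_rpow_inv_iff_of_pos ENNReal.toReal_nonneg _ hp0, h4]
  · gcongr
  · have : 0 < k - h := by linarith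
    positivity

/-- De Giorgi's iteration: a level `M` that is large enough bounds `u` almost everywhere. -/
theorem HasSobolevGradientZero.ae_le_of_rpow_le
    (hG : HasSobolevGradientZero Ω p u G) (hu : Measurable u) (hΩ : volume Ω < ⊤) (hp : 1 < p)
    (hlam : 0 ≤ lam)
    (heq : ∀ (φ : EuclideanSpace ℝ (Fin N) → ℝ)
      (H : EuclideanSpace ℝ (Fin N) → EuclideanSpace ℝ (Fin N)),
      HasSobolevGradientZero Ω p φ H →
        ∫ x in Ω, inner ℝ (‖G x‖ ^ (p - 2) • G x) (H x) =
          lam * ∫ x in Ω, |u x| ^ (q - 2) * u x * φ x)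
    (hq : 1 ≤ q) (hS0 : 0 ≤ S) (hp₁ : 1 ≤ p₁)
    (hp₁p : p₁ ≤ ENNReal.ofReal p) (hqq₁ : ENNReal.ofReal q ≤ q₁)
    (hpq₁ : 1 / p₁.toReal - 1 / q₁.toReal = 1 / N)
    (hS : ∀ φ : EuclideanSpace ℝ (Fin N) → ℝ, ContDiff ℝ 1 φ → HasCompactSupport φ →
      eLpNorm φ q₁ volume ≤ ENNReal.ofReal S * eLpNorm (gradient φ) p₁ volume)
    (hN : 1 ≤ N) {a : ℝ} (ha : a = 1 - q / p + q / N) (ha0 : 0 < a) {M : ℝ} (hM : 0 < M)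
    (hMa : S * lam ^ (1 / p) * 2 ^ (((q - 1) / p + a) * (1 + N / q)) *
      (eLpNorm (fun x => max (u x) 0) (ENNReal.ofReal q) (volume.restrict Ω)).toReal ^ (q / N) ≤
        M ^ a) :
    ∀ᵐ x ∂(volume.restrict Ω), u x ≤ M := by
  have : IsFiniteMeasure (volume.restrict Ω) := ⟨by simpa using hΩ⟩
  have hp0 : 0 < p := by linarith
  have hq0 : 0 < q := by linarith
  have hN0 : (0 : ℝ) < N := by exact_mod_cast hN
  have huq : MemLp u (ENNReal.ofReal q) (volume.restrict Ω) :=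
    hG.memLp_of_le hΩ hp.le hp₁ hp₁p hqq₁ hS
  have hqσ : q * (1 / q - 1 / p + 1 / N) = a := by rw [ha]; field_simp
  have hσ : 0 ≤ 1 / q - 1 / p + 1 / (N : ℝ) := by
    rw [← hqσ] at ha0; exact (pos_of_mul_pos_right ha0 hq0.le).le
  set β : ℝ := (q - 1) / p + a with hβ
  have hq1 : 0 ≤ (q - 1) / p := div_nonneg (by linarith) hp0.le
  have hβ0 : 0 < β := by positivity
  set Y : ℝ → ℝ := fun k =>
    (eLpNorm (fun x => max (u x - k) 0) (ENNReal.ofReal q) (volume.restrict Ω)).toReal with hY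
  -- The levels start at `0`, so the initial norm is that of `u^+`, and never exceed `M`; hence `κ
  -- (n + 1) / (κ (n + 1) - κ n) ≤ 2 ^ (n + 1)`.
  set κ : ℕ → ℝ := fun n => M * (1 - (1 / 2) ^ n) with hκ
  have hpow : ∀ n : ℕ, (0 : ℝ) < (1 / 2) ^ n := fun n => by positivity
  have hpow1 : ∀ n : ℕ, ((1 : ℝ) / 2) ^ n ≤ 1 := fun n =>
    pow_le_one₀ (by norm_num) (by norm_num)
  have hκ0 : ∀ n, 0 ≤ κ n := fun n => mul_nonneg hM.le (by linarith [hpow1 n])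
  have hκM : ∀ n, κ n ≤ M := fun n => mul_le_of_le_one_right hM.le (by linarith [hpow n])
  have hκd : ∀ n, κ (n + 1) - κ n = M / 2 ^ (n + 1) := fun n => by
    simp only [hκ, one_div, inv_pow, pow_succ]
    field_simp
    ring
  have hY0 : ∀ k, 0 ≤ Y k := fun k => ENNReal.toReal_nonneg
  have hstep : ∀ n, Y (κ (n + 1)) ≤ (S * lam ^ (1 / p) / M ^ a) * (2 ^ β) ^ (n + 1) *
      Y (κ n) ^ (1 + q / N) := by
    intro n
    have hd0 : 0 < κ (n + 1) - κ n := by rw [hκd]; positivity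
    have h1 := hG.toReal_eLpNorm_posPart_le hu hΩ hp hlam heq hq hS0 hp₁ hp₁p hqq₁ hpq₁ hS hσ
      (hκ0 n) (sub_pos.1 hd0)
    change Y (κ (n + 1)) ≤ S * ((Y (κ n) / (κ (n + 1) - κ n)) ^ q) ^ (1 / q - 1 / p + 1 / (N : ℝ)) *
      (lam * ((κ (n + 1) / (κ (n + 1) - κ n)) ^ (q - 1) * Y (κ n) ^ q)) ^ (1 / p) at h1
    have hy := hY0 (κ n)
    set y := Y (κ n)
    have h2 : κ (n + 1) / (κ (n + 1) - κ n) ≤ 2 ^ (n + 1) := by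
      rw [div_le_iff₀ hd0, hκd, mul_div_cancel₀ _ (by positivity)]
      exact hκM _
    have h3 : 0 ≤ κ (n + 1) / (κ (n + 1) - κ n) := div_nonneg (hκ0 _) hd0.le
    have hq1' : 0 ≤ q - 1 := by linarith
    rw [← Real.rpow_mul (by positivity), hqσ, hκd, ← hκd] at h1
    calc Y (κ (n + 1)) ≤ S * (y / (κ (n + 1) - κ n)) ^ a *
          (lam * ((2 ^ (n + 1)) ^ (q - 1) * y ^ q)) ^ (1 / p) := by
          refine h1.trans ?_
          gcongr
      _ = S * (y ^ a / M ^ a * (2 ^ (n + 1)) ^ a) *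
          (lam ^ (1 / p) * ((2 ^ (n + 1)) ^ ((q - 1) / p) * y ^ (q / p))) := by
          rw [hκd, div_div_eq_mul_div, mul_div_right_comm, Real.mul_rpow (by positivity)
            (by positivity), Real.div_rpow hy hM.le, Real.mul_rpow hlam (by positivity),
            Real.mul_rpow (by positivity) (by positivity), ← Real.rpow_mul (by positivity),
            ← Real.rpow_mul hy, mul_one_div, mul_one_div]
      _ = S * lam ^ (1 / p) / M ^ a * ((2 ^ (n + 1)) ^ ((q - 1) / p) * (2 ^ (n + 1)) ^ a) *
          (y ^ a * y ^ (q / p)) := by ring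
      _ = _ := by
          rw [← Real.rpow_add (by positivity), ← Real.rpow_add_of_nonneg hy ha0.le (by positivity),
            ← hβ, ← Real.rpow_natCast, ← Real.rpow_natCast, ← Real.rpow_mul zero_le_two,
            ← Real.rpow_mul zero_le_two, mul_comm β]
          congr 2
          rw [ha]; ring
  have hlim : Tendsto (fun n => Y (κ n)) atTop (𝓝 0) := by
    have hδ : 0 < q / N := by positivity
    -- This `c` solves `c ^ δ * b = 1` with `b = 2 ^ β`; the smallness condition on the initial norm
    -- then becomes `hMa`, whence the exponent `β * (1 + N / q)` there.
    refine tendsto_zero_of_le_mul_rpow (δ := q / N) (c := (2 : ℝ) ^ (-(β * (N / q))))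
      (fun n => hY0 _) (by positivity) (by positivity) hδ (by positivity) ?_ ?_ hstep ?_
    · exact Real.rpow_lt_one_of_one_lt_of_neg one_lt_two (neg_lt_zero.2 (by positivity))
    · rw [← Real.rpow_mul zero_le_two, ← Real.rpow_add zero_lt_two]
      have : -(β * (N / q)) * (q / N) + β = 0 := by field_simp; ring
      rw [this, Real.rpow_zero]
    · have e0 : Y (κ 0) =
          (eLpNorm (fun x => max (u x) 0) (ENNReal.ofReal q) (volume.restrict Ω)).toReal := by
        simp [hY, hκ]
      rw [← e0] at hMa
      rw [Real.rpow_neg zero_le_two, ← one_div, le_div_iff₀ (by positivity)]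
      have e1 : (2 : ℝ) ^ (β * (1 + N / q)) = 2 ^ β * 2 ^ (β * (N / q)) := by
        rw [← Real.rpow_add zero_lt_two]; congr 1; ring
      rw [e1] at hMa
      calc _ = (S * lam ^ (1 / p) * (2 ^ β * 2 ^ (β * (N / q))) * Y (κ 0) ^ (q / N)) / M ^ a := by
            ring
        _ ≤ 1 := by rw [div_le_one (by positivity)]; exact hMa
  have hYM : ∀ n, Y M ≤ Y (κ n) := fun n => by
    refine ENNReal.toReal_mono (huq.posPart_sub _).2.ne (eLpNorm_mono fun x => ?_)
    rw [Real.norm_of_nonneg (le_max_right _ _), Real.norm_of_nonneg (le_max_right _ _)]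
    have := hκM n
    gcongr
  have hYM0 : Y M = 0 := le_antisymm (ge_of_tendsto' hlim hYM) (hY0 M)
  have hmem := huq.posPart_sub M
  have h0 : eLpNorm (fun x => max (u x - M) 0) (ENNReal.ofReal q) (volume.restrict Ω) = 0 :=
    ((ENNReal.toReal_eq_zero_iff _).1 hYM0).resolve_right hmem.2.ne
  rw [eLpNorm_eq_zero_iff hmem.1 (by simpa using hq0)] at h0
  filter_upwards [h0] with x hx
  have : u x - M ≤ 0 := (le_max_left _ _).trans hx.le
  linarith

end

/-! ### Uniformity in `q` and conclusion -/

/-- A lower bound, uniform in `q ≤ q₀`, of the exponent `1 - q / p + q / N`. -/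
theorem min_one_le_one_sub_div_add_div {N p q q₀ : ℝ} (hq : 0 ≤ q) (hqq₀ : q ≤ q₀) :
    min 1 (1 - q₀ / p + q₀ / N) ≤ 1 - q / p + q / N := by
  have e : ∀ r : ℝ, 1 - r / p + r / N = 1 + r * (1 / N - 1 / p) := fun r => by ring
  rw [e, e]
  rcases le_total 0 (1 / N - 1 / p) with h | h
  · exact (min_le_left _ _).trans (by linarith [mul_nonneg hq h])
  · exact (min_le_right _ _).trans (by linarith [mul_le_mul_of_nonpos_right hqq₀ h])

theorem exponent_le_uniform {N p q q₀ : ℝ} (hN : 1 ≤ N) (hp : 1 < p) (hq : 1 ≤ q)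
    (hqq₀ : q ≤ q₀) :
    ((q - 1) / p + (1 - q / p + q / N)) * (1 + N / q) ≤ (1 + 2 * q₀) * (1 + N) := by
  have h1 : (q - 1) / p ≤ q - 1 := div_le_self (by linarith) hp.le
  have h2 : q / N ≤ q := div_le_self (by linarith) hN
  have h3 : 0 ≤ q / p := by positivity
  have h4 : N / q ≤ N := div_le_self (by linarith) hq
  have h5 : 0 ≤ N / q := by positivity
  have h6 : 0 < q := by linarith
  exact mul_le_mul (by linarith) (by linarith) (by linarith) (by linarith)

theorem mainTheorem8 (N : ℕ) (hN : 1 ≤ N) (p q₀ : ℝ) (hp : 1 < p) (hpq₀ : p ≤ q₀)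
    (hq₀ : (q₀ : EReal) < sobolevExponent N p) :
    ∃ C : ℝ, 0 < C ∧
      ∀ Ω : Set (EuclideanSpace ℝ (Fin N)), IsOpen Ω → volume Ω < ⊤ →
      ∀ q : ℝ, p ≤ q → q ≤ q₀ →
      ∀ lam : ℝ, 0 < lam →
      ∀ u : EuclideanSpace ℝ (Fin N) → ℝ,
        IsLaneEmdenSolution Ω p q lam u → (∀ᵐ x ∂(volume.restrict Ω), 0 ≤ u x) →
        MemLp u ⊤ (volume.restrict Ω) ∧
        (eLpNorm u ⊤ (volume.restrict Ω)).toReal ≤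
          C * (lam ^ ((N : ℝ) / (p * q)) *
            (eLpNorm u (ENNReal.ofReal q) (volume.restrict Ω)).toReal) ^
              (p * q / (p * q - (q - p) * (N : ℝ))) := by
  obtain ⟨S, p₁, q₁, hS1, hp₁, hp₁p, hq₀q₁, hpq₁, hS⟩ := exists_sobolev_constant hN hp hpq₀ hq₀
  have hN1 : (1 : ℝ) ≤ N := by exact_mod_cast hN
  have hN0 : (0 : ℝ) < N := by linarith
  have hp0 : 0 < p := by linarith
  have hq₀0 : 0 < q₀ := by linarith
  set a₀ : ℝ := min 1 (1 - q₀ / p + q₀ / N) with ha₀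
  have ha₀0 : 0 < a₀ := by
    refine lt_min one_pos ?_
    have h := one_div_sub_lt_of_lt_sobolevExponent hN hp hpq₀ hq₀
    rw [lt_div_iff₀ hq₀0] at h
    have e : (1 / p - 1 / N) * q₀ = q₀ / p - q₀ / N := by ring
    linarith
  set E : ℝ := (1 + 2 * q₀) * (1 + N) with hE
  have hE0 : 0 ≤ E := by positivity
  have hSE : 1 ≤ S * 2 ^ E := one_le_mul_of_one_le_of_one_le hS1
    (Real.one_le_rpow one_le_two hE0)
  -- Since `S * 2 ^ E ≥ 1` and `a ≥ a₀`, the `a`-th power of this constant is still at least `S * 2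
  -- ^ E`, whatever `q` is.
  refine ⟨(S * 2 ^ E) ^ (1 / a₀), by positivity, ?_⟩
  intro Ω _ hΩ q hpq hqq₀ lam hlam u ⟨G, hG, heq⟩ hu0
  have : IsFiniteMeasure (volume.restrict Ω) := ⟨by simpa using hΩ⟩
  have hq1 : 1 ≤ q := by linarith
  have hq0 : 0 < q := by linarith
  have hqq₁ : ENNReal.ofReal q ≤ q₁ := (ENNReal.ofReal_le_ofReal hqq₀).trans hq₀q₁
  have hqne : ENNReal.ofReal q ≠ 0 := by simpa using hq0
  have huq : MemLp u (ENNReal.ofReal q) (volume.restrict Ω) :=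
    hG.memLp_of_le hΩ hp.le hp₁ hp₁p hqq₁ hS
  set a : ℝ := 1 - q / p + q / N with ha
  have ha₀a : a₀ ≤ a := min_one_le_one_sub_div_add_div hq0.le hqq₀
  have ha0 : 0 < a := ha₀0.trans_le ha₀a
  -- The denominator equals `p * N * a`, so the exponent of the theorem is exactly what turns a
  -- bound on `M ^ a` into one on `M`.
  have hθ : p * q / (p * q - (q - p) * (N : ℝ)) * a = q / N := by
    have h1 : p * q - (q - p) * (N : ℝ) = p * N * a := by rw [ha]; field_simp; ring
    rw [h1]; field_simp
  set θ : ℝ := p * q / (p * q - (q - p) * (N : ℝ)) with hθdef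
  set L : ℝ := (eLpNorm u (ENNReal.ofReal q) (volume.restrict Ω)).toReal with hL
  have hL0 : 0 ≤ L := ENNReal.toReal_nonneg
  set M : ℝ := (S * 2 ^ E) ^ (1 / a₀) * (lam ^ ((N : ℝ) / (p * q)) * L) ^ θ with hMdef
  have hM0 : 0 ≤ M := by positivity
  suffices hbound : ∀ᵐ x ∂(volume.restrict Ω), ‖u x‖ ≤ M by
    refine ⟨memLp_top_of_bound huq.1 M hbound, ENNReal.toReal_le_of_le_ofReal hM0 ?_⟩
    rw [eLpNorm_exponent_top]
    exact eLpNormEssSup_le_of_ae_bound hbound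
  -- The iteration needs a positive level `M`; if `L = 0`, then `u = 0` a.e. already.
  rcases hL0.eq_or_lt with hLz | hLpos
  · have h0 : eLpNorm u (ENNReal.ofReal q) (volume.restrict Ω) = 0 :=
      ((ENNReal.toReal_eq_zero_iff _).1 hLz.symm).resolve_right huq.2.ne
    rw [eLpNorm_eq_zero_iff huq.1 hqne] at h0
    filter_upwards [h0] with x hx
    simpa [hx] using hM0
  · have hMpos : 0 < M := by positivity
    -- The iteration cuts at superlevel sets, so it is run on a measurable representative.
    set v := huq.1.aemeasurable.mk u with hv
    have huv : u =ᵐ[volume.restrict Ω] v := huq.1.aemeasurable.ae_eq_mk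
    have hvL : (eLpNorm (fun x => max (v x) 0) (ENNReal.ofReal q) (volume.restrict Ω)).toReal =
        L := by
      rw [hL]
      congr 1
      refine eLpNorm_congr_ae ?_
      filter_upwards [huv, hu0] with x hx hx0
      rw [← hx, max_eq_left hx0]
    have hMa : S * lam ^ (1 / p) * 2 ^ (((q - 1) / p + a) * (1 + N / q)) * L ^ (q / N) ≤ M ^ a := by
      have h1 : M ^ a = (S * 2 ^ E) ^ (1 / a₀ * a) * (lam ^ (1 / p) * L ^ (q / N)) := by
        rw [hMdef, Real.mul_rpow (by positivity) (by positivity), ← Real.rpow_mul (by positivity),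
          ← Real.rpow_mul (by positivity), hθ, Real.mul_rpow (by positivity) hL0,
          ← Real.rpow_mul hlam.le, show (N : ℝ) / (p * q) * (q / N) = 1 / p by field_simp]
      have h2 : S * 2 ^ E ≤ (S * 2 ^ E) ^ (1 / a₀ * a) := by
        refine Real.self_le_rpow_of_one_le hSE ?_
        rwa [one_div_mul_eq_div, one_le_div ha₀0]
      have h3 : (2 : ℝ) ^ (((q - 1) / p + a) * (1 + N / q)) ≤ 2 ^ E :=
        Real.rpow_le_rpow_of_exponent_le one_le_two
          (exponent_le_uniform hN1 hp hq1 hqq₀)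
      calc _ = S * 2 ^ (((q - 1) / p + a) * (1 + N / q)) * (lam ^ (1 / p) * L ^ (q / N)) := by ring
        _ ≤ S * 2 ^ E * (lam ^ (1 / p) * L ^ (q / N)) := by gcongr
        _ ≤ _ := by rw [h1]; gcongr
    have key := (hG.congr huv).ae_le_of_rpow_le huq.1.aemeasurable.measurable_mk hΩ hp hlam.le
      (fun φ H hφ => by
        rw [heq φ H hφ]
        congr 1
        refine integral_congr_ae ?_
        filter_upwards [huv] with x hx
        rw [hx])
      hq1 (zero_le_one.trans hS1) hp₁ hp₁p hqq₁ hpq₁ hS hN ha ha0 hMpos (by rwa [hvL])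
    filter_upwards [key, huv, hu0] with x hx hxv hx0
    rw [Real.norm_of_nonneg hx0, hxv]
    exact hx
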